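/- Let $\mathcal W=(\mathcal W_t)_{t\ge 0}$ be a standard Brownian motion on a probability space $(\Omega,\mathcal F,P)$. Let $r>0$, $\delta\ge 0$, $\sigma>0$, $\gamma\in\mathbb R$ and $0<a<x<b$. Put $$S_t=x\,e^{(r-\delta-\sigma^2/2)t+\sigma\mathcal W_t},\qquad \tilde r=r-\gamma,\qquad \lambda=\gamma-r,\qquad \mu=-\Big(\frac{\sigma}{2}+\frac{\gamma-r+\delta}{\sigma}\Big),$$ $$a_1=\frac1\sigma\log\frac ax,\qquad b_1=\frac1\sigma\log\frac bx,$$ and define the hitting times (with $\inf\emptyset=\infty$) $$\tau_a=\inf\{t\ge0: e^{-\gamma t}S_t\le a\},\qquad \tau_b=\inf\{t\ge0: e^{-\gamma t}S_t\ge b\},$$ $$\tau_{a_1}=\inf\{t\ge0:\mathcal W_t+\mu t\le a_1\},\qquad \tau_{b_1}=\inf\{t\ge0:\mathcal W_t+\mu t\ge b_1\}.$$ If $\mu^2-2\lambda\ge 0$, then $e^{-\tilde r\tau_b}\mathbf 1_{\{\tau_b<\tau_a\}}$ and $e^{-\tilde r\tau_{b_1}}\mathbf 1_{\{\tau_{b_1}<\tau_{a_1}\}}$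 are integrable and $$\mathbf E\big[e^{-\tilde r\tau_b}\mathbf 1_{\{\tau_b<\tau_a\}}\big]=\mathbf E\big[e^{-\tilde r\tau_{b_1}}\mathbf 1_{\{\tau_{b_1}<\tau_{a_1}\}}\big].$$ If $\mu^2-2\lambda>0$, this common value equals $$\frac1C\Big(e^{\mu b_1-a_1\sqrt{\mu^2-2\lambda}}-e^{\mu b_1+a_1\sqrt{\mu^2-2\lambda}}\Big)=\frac1C\Big(b^{\frac\mu\sigma}a^{-\frac{\sqrt{\mu^2-2\lambda}}{\sigma}}x^{\lambda_1}-b^{\frac\mu\sigma}a^{\frac{\sqrt{\mu^2-2\lambda}}{\sigma}}x^{\lambda_2}\Big),$$ where $$C=\Big(\frac ba\Big)^{\frac{\sqrt{\mu^2-2\lambda}}{\sigma}}-\Big(\frac ab\Big)^{\frac{\sqrt{\mu^2-2\lambda}}{\sigma}},\qquad \lambda_1=\frac{-\mu+\sqrt{\mu^2-2\lambda}}{\sigma},\qquad \lambda_2=\frac{-\mu-\sqrt{\mu^2-2\lambda}}{\sigma}.$$ If $\mu^2-2\lambda=0$ (so that $C=0$), the common value is the limit of each of these two expressions when $\lambda$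 is replaced in them by $l<\lambda$, with $\mu,\sigma,a,b,x$ held fixed, and $l\uparrow\lambda$; explicitly, it equals $e^{\mu b_1}\,\dfrac{-a_1}{b_1-a_1}$. -/

import Mathlib

open MeasureTheory ProbabilityTheory Filter Topology
open scoped NNReal

namespace StockLoan

noncomputable section

/-- The price `S_t = x exp((r - δ - σ²/2) t + σ W_t)`, where `x` is the initial price. -/
def stock {Ω : Type*} (W : ℝ≥0 → Ω → ℝ) (r δ σ x : ℝ) : ℝ≥0 → Ω → ℝ :=
  fun t ω => x * Real.exp ((r - δ - σ ^ 2 / 2) * (t : ℝ) + σ * W t ω)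

/-- The discounted price `e^{-γ t} S_t`. -/
def discountedStock {Ω : Type*} (W : ℝ≥0 → Ω → ℝ) (r δ σ γ x : ℝ) : ℝ≥0 → Ω → ℝ :=
  fun t ω => Real.exp (-γ * (t : ℝ)) * stock W r δ σ x t ω

/-- Brownian motion with drift, `W_t + μ t`. -/
def driftedBM {Ω : Type*} (W : ℝ≥0 → Ω → ℝ) (μ : ℝ) : ℝ≥0 → Ω → ℝ :=
  fun t ω => W t ω + μ * (t : ℝ)

/-- `inf {t ≥ 0 : X_t ≤ c}`, equal to `⊤` when the level is never reached. -/
def hitBelow {Ω : Type*} (X : ℝ≥0 → Ω → ℝ) (c : ℝ) : Ω → WithTop ℝ≥0 :=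
  hittingAfter X (Set.Iic c) 0

/-- `inf {t ≥ 0 : X_t ≥ c}`, equal to `⊤` when the level is never reached. -/
def hitAbove {Ω : Type*} (X : ℝ≥0 → Ω → ℝ) (c : ℝ) : Ω → WithTop ℝ≥0 :=
  hittingAfter X (Set.Ici c) 0

/-- The random variable `e^{-ρ τ} 1_{τ < τ'}`. On the event `τ < τ'` the time `τ` is finite,
so the default value of `untopD` plays no role. -/
def discountBefore {Ω : Type*} (ρ : ℝ) (τ τ' : Ω → WithTop ℝ≥0) : Ω → ℝ :=
  Set.indicator {ω | τ ω < τ' ω} (fun ω => Real.exp (-ρ * (((τ ω).untopD 0 : ℝ≥0) : ℝ)))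

/-- The drift `μ = -(σ/2 + (γ - r + δ)/σ)`. -/
def drift (r δ σ γ : ℝ) : ℝ := -(σ / 2 + (γ - r + δ) / σ)

/-- The exponent `(-μ + √(μ² - 2l))/σ`. -/
def lambda1 (σ μ l : ℝ) : ℝ := (-μ + Real.sqrt (μ ^ 2 - 2 * l)) / σ

/-- The exponent `(-μ - √(μ² - 2l))/σ`. -/
def lambda2 (σ μ l : ℝ) : ℝ := (-μ - Real.sqrt (μ ^ 2 - 2 * l)) / σ

/-- The constant `C = (b/a)^{√(μ² - 2l)/σ} - (a/b)^{√(μ² - 2l)/σ}`. -/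
def normC (σ a b μ l : ℝ) : ℝ :=
  (b / a) ^ (Real.sqrt (μ ^ 2 - 2 * l) / σ) - (a / b) ^ (Real.sqrt (μ ^ 2 - 2 * l) / σ)

/-- The closed form in the levels `a₁`, `b₁`; meaningful for `μ² - 2l > 0`, where `C > 0`. -/
def expForm (σ a b a₁ b₁ μ l : ℝ) : ℝ :=
  1 / normC σ a b μ l *
    (Real.exp (μ * b₁ - a₁ * Real.sqrt (μ ^ 2 - 2 * l))
      - Real.exp (μ * b₁ + a₁ * Real.sqrt (μ ^ 2 - 2 * l)))

/-- The closed form in powers of the initial price `x`; meaningful for `μ² - 2l > 0`. -/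
def powForm (σ a b x μ l : ℝ) : ℝ :=
  1 / normC σ a b μ l *
    (b ^ (μ / σ) * a ^ (-(Real.sqrt (μ ^ 2 - 2 * l) / σ)) * x ^ lambda1 σ μ l
      - b ^ (μ / σ) * a ^ (Real.sqrt (μ ^ 2 - 2 * l) / σ) * x ^ lambda2 σ μ l)

end

end StockLoan

/-! ### Regular Brownian motion, optional stopping, exponential martingales. -/

namespace StockLoan

variable {Ω : Type*}

/-! The discounted price is `x * exp (σ X)` with `X` the drifted motion, so the two pairs of hitting
times agree path by path and everything concerns the exit of `X` from an interval (a, b) around 0.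
If z² = μ² - 2l, then exp(l t + (z - μ) X_t) is the exponential martingale of parameter z - μ. With
θ = √(μ² - 2l) > 0, combining z = θ and z = -θ gives the martingale e^{lt} e^{-μX} sinh(θ(X - a)),
which vanishes at the barrier a. Stopping it at the exit time leaves only the contribution of b and
gives the closed form (`integral_discountBefore`). Since l may be positive, passing from truncated
exit times to the exit time needs an exponential moment. The imaginary choice z = iκ gives a cosine
martingale, bounded below on [a, b], whose rate (μ² + κ²)/2 exceeds every admissible l
(`exists_exit_bound`). This supplies the dominating function and shows that the exit time is almost
surely finite. At μ² = 2λ, the expectation is left continuous in the rate by dominated convergence,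
while the quotient of hyperbolic sines tends to the quotient of its arguments. -/

theorem isClosed_hitting_times {Y : ℝ≥0 → Ω → ℝ} {C : Set ℝ} (hC : IsClosed C) {ω : Ω}
    (hc : Continuous (Y · ω)) : IsClosed {i : ℝ≥0 | 0 ≤ i ∧ Y i ω ∈ C} := by
  simp only [zero_le, true_and]
  exact hC.preimage hc

/-- A continuous path lies in the closed set `C` at the hitting time of `C`. -/
theorem mem_of_hittingAfter_eq {Y : ℝ≥0 → Ω → ℝ} {C : Set ℝ} (hC : IsClosed C) {ω : Ω}
    (hc : Continuous (Y · ω)) {t : ℝ≥0} (h : hittingAfter Y C 0 ω = t) : Y t ω ∈ C := by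
  have hex : ∃ j, 0 ≤ j ∧ Y j ω ∈ C := by
    by_contra hno
    push Not at hno
    rw [hittingAfter_eq_top_iff.2 hno] at h
    exact WithTop.top_ne_coe h
  rw [hittingAfter, if_pos hex, WithTop.coe_inj] at h
  exact h ▸ ((isClosed_hitting_times hC hc).csInf_mem hex (OrderBot.bddBelow _)).2

variable [mΩ : MeasurableSpace Ω] {P : Measure Ω}

/-- A Brownian motion all of whose paths are continuous and start at `0`, with measurable
marginals. -/
structure IsRegularBrownian (B : ℝ≥0 → Ω → ℝ) (P : Measure Ω) : Prop where
  pre : IsPreBrownianReal B P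
  meas : ∀ t, Measurable (B t)
  cont : ∀ ω, Continuous (B · ω)
  zero : ∀ ω, B 0 ω = 0

/-- Keep `W` on a measurable almost sure event of good paths and put 0 elsewhere. Measurable
versions at countably many dense times suffice, by continuity. With every path good, hitting times
are stopping times for the uncompleted natural filtration. -/
theorem exists_isRegularBrownian {W : ℝ≥0 → Ω → ℝ} (hW : IsBrownianReal W P) :
    ∃ B : ℝ≥0 → Ω → ℝ, IsRegularBrownian B P ∧ ∀ᵐ ω ∂P, ∀ t, W t ω = B t ω := by
  classical
  obtain ⟨D, hDc, hDd⟩ := TopologicalSpace.exists_countable_dense ℝ≥0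
  have hae : ∀ᵐ ω ∂P, Continuous (W · ω) ∧ W 0 ω = 0 ∧
      ∀ q ∈ D, W q ω = (hW.aemeasurable q).mk (W q) ω := by
    filter_upwards [hW.cont, hW.eval_zero_ae_eq_zero,
      (ae_ball_iff hDc).2 fun q _ => (hW.aemeasurable q).ae_eq_mk] with ω h1 h2 h3
    exact ⟨h1, h2, h3⟩
  obtain ⟨G, hGae, hGm, hGsub⟩ := hae.exists_measurable_mem
  let B : ℝ≥0 → Ω → ℝ := fun t ω => if ω ∈ G then W t ω else 0
  have hWB : ∀ᵐ ω ∂P, ∀ t, W t ω = B t ω := by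
    filter_upwards [hGae] with ω hω t
    simp [B, hω]
  refine ⟨B, ⟨hW.toIsPreBrownianReal.congr fun t => hWB.mono fun ω h => h t, fun t => ?_,
    fun ω => ?_, fun ω => ?_⟩, hWB⟩
  · have hcl : t ∈ closure D := hDd t
    obtain ⟨u, huD, hut⟩ := mem_closure_iff_seq_limit.1 hcl
    refine measurable_of_tendsto_metrizable (f := fun n ω =>
      if ω ∈ G then (hW.aemeasurable (u n)).mk (W (u n)) ω else 0) (fun n => ?_) ?_
    · exact Measurable.ite hGm (hW.aemeasurable (u n)).measurable_mk measurable_const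
    · rw [tendsto_pi_nhds]
      intro ω
      by_cases hω : ω ∈ G
      · have h := hGsub _ hω
        have h1 : Tendsto (fun n => W (u n) ω) atTop (𝓝 (W t ω)) := (h.1.tendsto t).comp hut
        simpa [B, hω, h.2.2 _ (huD _)] using h1.congr fun n => h.2.2 _ (huD n)
      · simp [B, hω]
  · by_cases hω : ω ∈ G
    · simpa [B, hω] using (hGsub _ hω).1
    · simpa [B, hω] using continuous_const
  · by_cases hω : ω ∈ G
    · simpa [B, hω] using (hGsub _ hω).2.1
    · simp [B, hω]

/-- The optional stopping theorem in continuous time, for a martingale with continuous paths. -/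
theorem integral_martingale_stopped [IsProbabilityMeasure P] {ℱ : Filtration ℝ≥0 mΩ}
    {f : ℝ≥0 → Ω → ℝ} (hf : Martingale f ℱ P) (hc : ∀ ω, Continuous (f · ω))
    {ρ : Ω → ℝ≥0} (hρ : IsStoppingTime ℱ fun ω => (ρ ω : WithTop ℝ≥0)) {N : ℕ}
    (hN : ∀ ω, ρ ω ≤ N) :
    Integrable (fun ω => f (ρ ω) ω) P ∧ ∫ ω, f (ρ ω) ω ∂P = ∫ ω, f 0 ω ∂P := by
  -- Round `ρ` up to the grid of mesh 1/(n+1): these are stopping times with countably many values,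
  -- decreasing to `ρ` within one mesh, and still bounded by the integer `N`.
  let d : ℕ → Ω → ℝ≥0 := fun n ω => (⌈ρ ω * (n + 1)⌉₊ : ℝ≥0) / (n + 1)
  have hn (n : ℕ) : (0 : ℝ≥0) < n + 1 := by positivity
  have hd : ∀ n, IsStoppingTime ℱ fun ω => (d n ω : WithTop ℝ≥0) := by
    intro n s
    have key : {ω | (d n ω : WithTop ℝ≥0) ≤ s}
        = {ω | (ρ ω : WithTop ℝ≥0) ≤ ((⌊s * (n + 1)⌋₊ : ℝ≥0) / (n + 1) : ℝ≥0)} := by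
      ext ω
      simp only [Set.mem_ofPred_eq, WithTop.coe_le_coe, d]
      rw [div_le_iff₀ (hn n), le_div_iff₀ (hn n), ← Nat.le_floor_iff zero_le, Nat.ceil_le]
    rw [key]
    refine ℱ.mono ?_ _ (hρ _)
    rw [div_le_iff₀ (hn n)]
    exact Nat.floor_le zero_le
  have hdN : ∀ n ω, (d n ω : WithTop ℝ≥0) ≤ ((N : ℝ≥0) : WithTop ℝ≥0) := by
    intro n ω
    rw [WithTop.coe_le_coe]
    simp only [d]
    rw [div_le_iff₀ (hn n)]
    have : ⌈ρ ω * (n + 1)⌉₊ ≤ N * (n + 1) := by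
      rw [Nat.ceil_le]
      push_cast
      gcongr
      exact hN ω
    exact_mod_cast this
  have hcount : ∀ n, (Set.range fun ω => (d n ω : WithTop ℝ≥0)).Countable := by
    intro n
    refine (Set.countable_range fun k : ℕ => (((k : ℝ≥0) / (n + 1) : ℝ≥0) : WithTop ℝ≥0)).mono ?_
    rintro _ ⟨ω, rfl⟩
    exact ⟨_, rfl⟩
  have hval : ∀ n, (fun ω => f (d n ω) ω) =ᵐ[P] P[f N | (hd n).measurableSpace] := fun n =>
    hf.stoppedValue_ae_eq_condExp_of_le_const_of_countable_range (hd n) (hdN n) (hcount n)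
  have hdlim : ∀ ω, Tendsto (fun n => d n ω) atTop (𝓝 (ρ ω)) := by
    intro ω
    have h1 : Tendsto (fun n : ℕ => ρ ω + 1 / ((n : ℝ≥0) + 1)) atTop (𝓝 (ρ ω)) := by
      simpa using tendsto_const_nhds.add (tendsto_one_div_add_atTop_nhds_zero_nat (𝕜 := ℝ≥0))
    refine tendsto_of_tendsto_of_tendsto_of_le_of_le tendsto_const_nhds h1 (fun n => ?_)
      (fun n => ?_)
    · simp only [d]
      rw [le_div_iff₀ (hn n)]
      exact Nat.le_ceil _
    · simp only [d]
      rw [div_le_iff₀ (hn n), add_mul, one_div_mul_cancel (hn n).ne']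
      exact (Nat.ceil_lt_add_one zero_le).le
  have hlim : ∀ ω, Tendsto (fun n => f (d n ω) ω) atTop (𝓝 (f (ρ ω) ω)) := fun ω =>
    ((hc ω).tendsto _).comp (hdlim ω)
  -- All the discretely stopped values are conditional expectations of the single variable `f N`,
  -- hence uniformly integrable; this turns pointwise convergence into L¹ convergence.
  have hUI : UniformIntegrable (fun n => P[f N | (hd n).measurableSpace]) 1 P :=
    (hf.integrable N).uniformIntegrable_condExp fun n => (hd n).measurableSpace_le
  have hUI' : UniformIntegrable (fun n ω => f (d n ω) ω) 1 P :=
    hUI.ae_eq fun n => (hval n).symm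
  have hmeas : AEStronglyMeasurable (fun ω => f (ρ ω) ω) P :=
    aestronglyMeasurable_of_tendsto_ae atTop (fun n => hUI'.1 n) (ae_of_all _ hlim)
  have hmem : MemLp (fun ω => f (ρ ω) ω) 1 P :=
    hUI'.memLp_of_ae_tendsto (ae_of_all _ hlim)
  refine ⟨memLp_one_iff_integrable.1 hmem, ?_⟩
  have hL1 := tendsto_Lp_finite_of_tendsto_ae le_rfl ENNReal.one_ne_top (fun n => hUI'.1 n) hmem
    hUI'.2.1 (ae_of_all _ hlim)
  have hint := tendsto_integral_of_L1' _ hmeas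
    (Eventually.of_forall fun n => memLp_one_iff_integrable.1 (hUI'.memLp n)) hL1
  have hconst : ∀ n, ∫ ω, f (d n ω) ω ∂P = ∫ ω, f 0 ω ∂P := by
    intro n
    rw [integral_congr_ae (hval n), integral_condExp (hd n).measurableSpace_le]
    have := hf.setIntegral_eq (zero_le (a := (N : ℝ≥0))) MeasurableSet.univ
    simpa using this.symm
  simp only [hconst] at hint
  exact tendsto_nhds_unique hint tendsto_const_nhds

/-- The hitting time of a closed set by a continuous adapted process is a stopping time. -/
theorem isStoppingTime_hittingAfter_isClosed {ℱ : Filtration ℝ≥0 mΩ} {Y : ℝ≥0 → Ω → ℝ}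
    (hY : ∀ t, Measurable[ℱ t] (Y t)) (hc : ∀ ω, Continuous (Y · ω)) {C : Set ℝ}
    (hC : IsClosed C) (hne : C.Nonempty) : IsStoppingTime ℱ (hittingAfter Y C 0) := by
  intro t
  obtain ⟨D, hDc, hDd⟩ := TopologicalSpace.exists_countable_dense (Set.Icc (0 : ℝ≥0) t)
  -- By compactness, the path meets the closed set on [0, t] exactly when its distance to the set
  -- has infimum zero there, and continuity lets a countable dense set of times detect this.
  have key : {ω | hittingAfter Y C 0 ω ≤ t}
      = ⋂ n : ℕ, ⋃ q ∈ D, {ω | Metric.infDist (Y q ω) C < 1 / ((n : ℝ) + 1)} := by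
    ext ω
    have hdist : Continuous fun s => Metric.infDist (Y s ω) C :=
      (Metric.continuous_infDist_pt C).comp (hc ω)
    have hle : hittingAfter Y C 0 ω ≤ t ↔ ∃ j ∈ Set.Icc 0 t, Y j ω ∈ C := by
      constructor
      · intro h
        lift hittingAfter Y C 0 ω to ℝ≥0 using ne_top_of_le_ne_top WithTop.coe_ne_top h with u hu
        exact ⟨u, ⟨zero_le, WithTop.coe_le_coe.1 h⟩, mem_of_hittingAfter_eq hC (hc ω) hu.symm⟩
      · rintro ⟨j, hj, hjC⟩
        exact (hittingAfter_le_of_mem hj.1 hjC).trans (by exact_mod_cast hj.2)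
    simp only [Set.mem_ofPred_eq, Set.mem_iInter, Set.mem_iUnion, exists_prop, hle]
    constructor
    · rintro ⟨j, hj, hjC⟩ n
      have hopen : IsOpen {s : Set.Icc (0 : ℝ≥0) t |
          Metric.infDist (Y s ω) C < 1 / ((n : ℝ) + 1)} :=
        isOpen_lt (hdist.comp continuous_subtype_val) continuous_const
      obtain ⟨q, hq, hqD⟩ := hDd.inter_open_nonempty _ hopen ⟨⟨j, hj⟩, by
        simp only [Set.mem_ofPred_eq, Metric.infDist_zero_of_mem hjC]; positivity⟩
      exact ⟨q, hqD, hq⟩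
    · intro h
      obtain ⟨j, hj, hmin⟩ := (isCompact_Icc (a := (0 : ℝ≥0)) (b := t)).exists_isMinOn
        ⟨0, by simp⟩ hdist.continuousOn
      refine ⟨j, hj, (hC.mem_iff_infDist_zero hne).2 (le_antisymm ?_ Metric.infDist_nonneg)⟩
      refine ge_of_tendsto' (tendsto_one_div_add_atTop_nhds_zero_nat (𝕜 := ℝ)) fun n => ?_
      obtain ⟨q, -, hq⟩ := h n
      exact (hmin q.2).trans hq.le
  rw [key]
  refine MeasurableSet.iInter fun n => MeasurableSet.biUnion hDc fun q _ => ?_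
  have h1 : Measurable[ℱ t] (Y q) := (hY q).mono (ℱ.mono q.2.2) le_rfl
  exact measurableSet_lt (Metric.continuous_infDist_pt C |>.measurable.comp h1) measurable_const

/-- The filtration generated by a regular Brownian motion. -/
noncomputable def IsRegularBrownian.filtration {B : ℝ≥0 → Ω → ℝ} (hB : IsRegularBrownian B P) :
    Filtration ℝ≥0 mΩ :=
  Filtration.natural B fun t => (hB.meas t).stronglyMeasurable

theorem IsRegularBrownian.measurable_filtration {B : ℝ≥0 → Ω → ℝ} (hB : IsRegularBrownian B P)
    (t : ℝ≥0) : Measurable[hB.filtration t] (B t) :=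
  (Filtration.stronglyAdapted_natural fun t => (hB.meas t).stronglyMeasurable).adapted t

/-- The exponential martingale `exp (c B_t - c² t / 2)` with complex parameter `c`. -/
noncomputable def expMart (B : ℝ≥0 → Ω → ℝ) (c : ℂ) (t : ℝ≥0) (ω : Ω) : ℂ :=
  Complex.exp (c * B t ω - c ^ 2 / 2 * t)

theorem IsRegularBrownian.integrable_cexp {B : ℝ≥0 → Ω → ℝ} (hB : IsRegularBrownian B P)
    (c : ℂ) (t : ℝ≥0) : Integrable (fun ω => Complex.exp (c * B t ω)) P := by
  have h : Integrable (fun x : ℝ => Complex.exp (c * x)) (gaussianReal 0 t) := by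
    refine integrable_cexp_mul_of_re_mem_integrableExpSet aemeasurable_id ?_
    simp
  exact (hB.pre.hasLaw_eval t).map_eq ▸ h |>.comp_measurable (hB.meas t)

theorem IsRegularBrownian.integral_cexp {B : ℝ≥0 → Ω → ℝ} (hB : IsRegularBrownian B P)
    (c : ℂ) (t : ℝ≥0) : ∫ ω, Complex.exp (c * B t ω) ∂P = Complex.exp (c ^ 2 / 2 * t) := by
  have := complexMGF_gaussianReal (hB.pre.hasLaw_eval t).map_eq c
  rw [complexMGF] at this
  rw [this]
  congr 1
  simp
  ring

theorem IsRegularBrownian.shift {B : ℝ≥0 → Ω → ℝ} (hB : IsRegularBrownian B P) (s : ℝ≥0) :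
    IsRegularBrownian (fun t ω => B (s + t) ω - B s ω) P where
  pre := hB.pre.shift s
  meas t := (hB.meas _).sub (hB.meas _)
  cont ω := by have := hB.cont ω; fun_prop
  zero ω := by simp

theorem IsRegularBrownian.integrable_expMart {B : ℝ≥0 → Ω → ℝ} (hB : IsRegularBrownian B P)
    (c : ℂ) (t : ℝ≥0) : Integrable (expMart B c t) P := by
  have : expMart B c t = fun ω => Complex.exp (c * B t ω) * Complex.exp (-(c ^ 2 / 2 * t)) := by
    ext ω
    rw [expMart, ← Complex.exp_add, sub_eq_add_neg]
  rw [this]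
  exact (hB.integrable_cexp c t).mul_const _

/-- The value at s + u is the value at s times the exponential of the increment. That factor has
mean one and is independent of the path up to s, which determines `A`. -/
theorem IsRegularBrownian.setIntegral_expMart {B : ℝ≥0 → Ω → ℝ} (hB : IsRegularBrownian B P)
    (c : ℂ) {s t : ℝ≥0} (hst : s ≤ t) {A : Set Ω} (hA : MeasurableSet[hB.filtration s] A) :
    ∫ ω in A, expMart B c s ω ∂P = ∫ ω in A, expMart B c t ω ∂P := by
  obtain ⟨u, rfl⟩ := exists_add_of_le hst
  have hAm : MeasurableSet A := hB.filtration.le s _ hA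
  let past : Ω → (Set.Iic s → ℝ) := fun ω i => B i ω
  let fut : Ω → (ℝ≥0 → ℝ) := fun ω t => B (s + t) ω - B s ω
  have hpast : Measurable past := measurable_pi_lambda _ fun i => hB.meas i
  have hA' : MeasurableSet[MeasurableSpace.comap past inferInstance] A := by
    have h : hB.filtration s = MeasurableSpace.comap past inferInstance :=
      Filtration.natural_eq_comap B (fun t => (hB.meas t).stronglyMeasurable) s
    rwa [h] at hA
  obtain ⟨S, hS, rfl⟩ := hA'
  let F : (Set.Iic s → ℝ) → ℂ := S.indicator fun p =>
    Complex.exp (c * p ⟨s, Set.self_mem_Iic⟩ - c ^ 2 / 2 * s)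
  let G : (ℝ≥0 → ℝ) → ℂ := fun p => Complex.exp (c * p u - c ^ 2 / 2 * u)
  have hF : Measurable F := Measurable.indicator (by fun_prop) hS
  have hG : Measurable G := by fun_prop
  have hind : IndepFun (F ∘ past) (G ∘ fut) P := (hB.pre.indepFun_shift s).symm.comp hF hG
  have hfut : ∫ ω, (G ∘ fut) ω ∂P = 1 := by
    have h1 := (hB.shift s).integral_cexp c u
    have h2 : (G ∘ fut) = fun ω => Complex.exp (c * ((B (s + u) ω - B s ω : ℝ) : ℂ))
        * Complex.exp (-(c ^ 2 / 2 * u)) := by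
      ext ω
      simp only [Function.comp, G, fut]
      rw [← Complex.exp_add, sub_eq_add_neg]
    rw [h2, integral_mul_const, h1, ← Complex.exp_add]
    simp
  have hmul := hind.integral_fun_mul_eq_mul_integral
    (hF.comp hpast).aestronglyMeasurable
    (hG.comp (measurable_pi_lambda _ fun t => (hB.shift s).meas t)).aestronglyMeasurable
  rw [hfut, mul_one] at hmul
  rw [← integral_indicator hAm, ← integral_indicator hAm]
  have e1 : ∀ ω, (past ⁻¹' S).indicator (expMart B c s) ω = (F ∘ past) ω := by
    intro ω
    by_cases h : past ω ∈ S
    · simp [F, h, expMart, Set.indicator_of_mem, past]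
    · simp [F, h]
  have e2 : ∀ ω, (past ⁻¹' S).indicator (expMart B c (s + u)) ω
      = (F ∘ past) ω * (G ∘ fut) ω := by
    intro ω
    by_cases h : past ω ∈ S
    · have h' : (fun i : Set.Iic s => B i ω) ∈ S := h
      simp only [Set.indicator, Set.mem_preimage, h, if_true, F, G, fut, past,
        Function.comp, expMart]
      rw [← Complex.exp_add]
      congr 1
      push_cast
      ring
    · simp [F, h]
  simp_rw [e1, e2]
  exact hmul.symm

/-- The complex weight `w` carries amplitude and phase, so one statement covers both the hyperbolic
and the trigonometric martingales. -/
theorem IsRegularBrownian.martingale_re_expMart [IsProbabilityMeasure P] {B : ℝ≥0 → Ω → ℝ}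
    (hB : IsRegularBrownian B P) (w c : ℂ) :
    Martingale (fun t ω => (w * expMart B c t ω).re) hB.filtration P := by
  have hint : ∀ t, Integrable (fun ω => (w * expMart B c t ω).re) P := fun t =>
    ((hB.integrable_expMart c t).const_mul w).re
  have hsm : ∀ t, StronglyMeasurable[hB.filtration t] (fun ω => (w * expMart B c t ω).re) := by
    intro t
    have h := hB.measurable_filtration t
    refine Measurable.stronglyMeasurable ?_
    unfold expMart
    fun_prop
  refine ⟨hsm, fun s t hst => ?_⟩
  refine (ae_eq_condExp_of_forall_setIntegral_eq (hB.filtration.le s) (hint t)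
    (fun _ _ _ => (hint s).integrableOn) (fun A hA _ => ?_)
    (hsm s).aestronglyMeasurable).symm
  have hre : ∀ r, ∫ ω in A, (w * expMart B c r ω).re ∂P
      = (w * ∫ ω in A, expMart B c r ω ∂P).re := by
    intro r
    rw [← integral_const_mul]
    exact integral_re ((hB.integrable_expMart c r).const_mul w).integrableOn
  rw [hre, hre, hB.setIntegral_expMart c hst hA]

end StockLoan

/-! ### Exit from an interval: truncation and exponential moments. -/

namespace StockLoan

variable {Ω : Type*}

theorem continuous_driftedBM {B : ℝ≥0 → Ω → ℝ} {ω : Ω} (hc : Continuous (B · ω)) (μ : ℝ) :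
    Continuous (driftedBM B μ · ω) := by
  unfold driftedBM
  fun_prop

/-- Up to and including the exit time, a continuous path started in `(a, b)` stays in `[a, b]`. -/
theorem mem_Icc_of_le_exit {Y : ℝ≥0 → Ω → ℝ} {ω : Ω} (hc : Continuous (Y · ω)) {a b : ℝ}
    (h0 : Y 0 ω ∈ Set.Icc a b) {s : ℝ≥0}
    (hs : (s : WithTop ℝ≥0) ≤ min (hitBelow Y a ω) (hitAbove Y b ω)) :
    Y s ω ∈ Set.Icc a b := by
  -- Time 0 is separate because it is not a limit of earlier times; any other s is, and earlier the
  -- path has met neither barrier.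
  rcases eq_or_ne s 0 with rfl | hs0
  · exact h0
  have hcl : s ∈ closure (Set.Iio s) := by
    rw [closure_Iio' ⟨0, pos_of_ne_zero hs0⟩]
    exact Set.self_mem_Iic
  have hsub : closure (Set.Iio s) ⊆ (Y · ω) ⁻¹' Set.Icc a b := by
    refine closure_minimal (fun u hu => ?_) (isClosed_Icc.preimage hc)
    have hu' : (u : WithTop ℝ≥0) < s := WithTop.coe_lt_coe.2 hu
    have h1 := notMem_of_lt_hittingAfter (hu'.trans_le (hs.trans (min_le_left _ _))) zero_le
    have h2 := notMem_of_lt_hittingAfter (hu'.trans_le (hs.trans (min_le_right _ _))) zero_le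
    simp only [Set.mem_Iic, Set.mem_Ici, not_le] at h1 h2
    exact ⟨h1.le, h2.le⟩
  exact hsub hcl

/-- The exit time from `(a, b)`, truncated at `N`. -/
noncomputable def truncExit (Y : ℝ≥0 → Ω → ℝ) (a b : ℝ) (N : ℕ) (ω : Ω) : ℝ≥0 :=
  (min (min (hitBelow Y a ω) (hitAbove Y b ω)) ((N : ℝ≥0) : WithTop ℝ≥0)).untopD 0

theorem coe_truncExit (Y : ℝ≥0 → Ω → ℝ) (a b : ℝ) (N : ℕ) (ω : Ω) :
    (truncExit Y a b N ω : WithTop ℝ≥0)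
      = min (min (hitBelow Y a ω) (hitAbove Y b ω)) ((N : ℝ≥0) : WithTop ℝ≥0) := by
  have h : min (min (hitBelow Y a ω) (hitAbove Y b ω)) ((N : ℝ≥0) : WithTop ℝ≥0) ≠ ⊤ :=
    ne_top_of_le_ne_top WithTop.coe_ne_top (min_le_right _ _)
  rw [truncExit]
  lift min (min (hitBelow Y a ω) (hitAbove Y b ω)) ((N : ℝ≥0) : WithTop ℝ≥0) to ℝ≥0 using h with u
  rfl

theorem truncExit_le (Y : ℝ≥0 → Ω → ℝ) (a b : ℝ) (N : ℕ) (ω : Ω) : truncExit Y a b N ω ≤ N := by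
  rw [← WithTop.coe_le_coe, coe_truncExit]
  exact min_le_right _ _

theorem truncExit_mono (Y : ℝ≥0 → Ω → ℝ) (a b : ℝ) (ω : Ω) :
    Monotone fun N => truncExit Y a b N ω := by
  intro N M h
  rw [← WithTop.coe_le_coe, coe_truncExit, coe_truncExit]
  exact min_le_min le_rfl (by exact_mod_cast h)

theorem truncExit_eq {Y : ℝ≥0 → Ω → ℝ} {a b : ℝ} {ω : Ω} {t : ℝ≥0}
    (ht : min (hitBelow Y a ω) (hitAbove Y b ω) = t) {N : ℕ} (hN : t ≤ N) :
    truncExit Y a b N ω = t := by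
  rw [← WithTop.coe_inj, coe_truncExit, ht]
  exact min_eq_left (by exact_mod_cast hN)

theorem truncExit_eq_of_top {Y : ℝ≥0 → Ω → ℝ} {a b : ℝ} {ω : Ω}
    (ht : min (hitBelow Y a ω) (hitAbove Y b ω) = ⊤) (N : ℕ) :
    truncExit Y a b N ω = N := by
  rw [← WithTop.coe_inj, coe_truncExit, ht]
  exact min_eq_right le_top

variable [mΩ : MeasurableSpace Ω] {P : Measure Ω}

namespace IsRegularBrownian

variable {B : ℝ≥0 → Ω → ℝ}

theorem measurable_driftedBM (hB : IsRegularBrownian B P) (μ : ℝ) (t : ℝ≥0) :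
    Measurable[hB.filtration t] (driftedBM B μ t) := by
  have h := hB.measurable_filtration t
  unfold driftedBM
  fun_prop

theorem isStoppingTime_hitBelow (hB : IsRegularBrownian B P) (μ c : ℝ) :
    IsStoppingTime hB.filtration (hitBelow (driftedBM B μ) c) :=
  isStoppingTime_hittingAfter_isClosed (hB.measurable_driftedBM μ)
    (fun ω => continuous_driftedBM (hB.cont ω) μ) isClosed_Iic Set.nonempty_Iic

theorem isStoppingTime_hitAbove (hB : IsRegularBrownian B P) (μ c : ℝ) :
    IsStoppingTime hB.filtration (hitAbove (driftedBM B μ) c) :=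
  isStoppingTime_hittingAfter_isClosed (hB.measurable_driftedBM μ)
    (fun ω => continuous_driftedBM (hB.cont ω) μ) isClosed_Ici Set.nonempty_Ici

theorem isStoppingTime_truncExit (hB : IsRegularBrownian B P) (μ a b : ℝ) (N : ℕ) :
    IsStoppingTime hB.filtration
      fun ω => (truncExit (driftedBM B μ) a b N ω : WithTop ℝ≥0) := by
  simp_rw [coe_truncExit]
  exact ((hB.isStoppingTime_hitBelow μ a).min (hB.isStoppingTime_hitAbove μ b)).min_const _

theorem measurable_truncExit (hB : IsRegularBrownian B P) (μ a b : ℝ) (N : ℕ) :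
    Measurable (truncExit (driftedBM B μ) a b N) := by
  have h := (hB.isStoppingTime_truncExit μ a b N).measurable'.untopD 0
  exact h

theorem driftedBM_truncExit_mem (hB : IsRegularBrownian B P) {μ a b : ℝ} (ha : a < 0) (hb : 0 < b)
    (N : ℕ) (ω : Ω) :
    driftedBM B μ (truncExit (driftedBM B μ) a b N ω) ω ∈ Set.Icc a b := by
  refine mem_Icc_of_le_exit (continuous_driftedBM (hB.cont ω) μ) ?_ ?_
  · simp [driftedBM, hB.zero ω, ha.le, hb.le]
  · rw [coe_truncExit]
    exact min_le_left _ _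

/-- Substituting B = X - μt, the coefficient of t in the exponent is -(z - μ)(z + μ)/2, which equals
l by `hz`. -/
theorem integral_truncExit [IsProbabilityMeasure P] (hB : IsRegularBrownian B P) (μ a b : ℝ)
    (N : ℕ) (w z : ℂ) {l : ℝ} (hz : z ^ 2 = ((μ ^ 2 - 2 * l : ℝ) : ℂ)) :
    Integrable (fun ω => (w * Complex.exp (l * (truncExit (driftedBM B μ) a b N ω : ℝ)
      + (z - μ) * driftedBM B μ (truncExit (driftedBM B μ) a b N ω) ω)).re) P ∧
    ∫ ω, (w * Complex.exp (l * (truncExit (driftedBM B μ) a b N ω : ℝ)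
      + (z - μ) * driftedBM B μ (truncExit (driftedBM B μ) a b N ω) ω)).re ∂P = w.re := by
  have h := integral_martingale_stopped (hB.martingale_re_expMart w (z - μ))
    (fun ω => by have := hB.cont ω; unfold expMart; fun_prop)
    (hB.isStoppingTime_truncExit μ a b N) (truncExit_le _ a b N)
  have e : ∀ t ω, expMart B (z - μ) t ω
      = Complex.exp (l * (t : ℝ) + (z - μ) * driftedBM B μ t ω) := by
    intro t ω
    rw [expMart, driftedBM]
    congr 1
    push_cast at hz ⊢
    linear_combination (-(t : ℝ) / 2 : ℂ) * hz
  have h0 : ∫ ω, (w * expMart B (z - μ) 0 ω).re ∂P = w.re := by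
    simp [expMart, hB.zero]
  rw [h0] at h
  simpa only [e] using h

end IsRegularBrownian

/-- The frequency of the trigonometric martingale used to bound the exit time from `(a, b)`. -/
noncomputable def exitFreq (a b : ℝ) : ℝ := Real.pi / (2 * (b - a))

/-- An exponential rate at which the exit time from `(a, b)` has a finite exponential moment. -/
noncomputable def exitRate (μ a b : ℝ) : ℝ := (μ ^ 2 + exitFreq a b ^ 2) / 2

theorem exitFreq_pos {a b : ℝ} (hab : a < b) : 0 < exitFreq a b := by
  have : 0 < b - a := sub_pos.2 hab
  unfold exitFreq
  positivity

theorem exitRate_pos (μ : ℝ) {a b : ℝ} (hab : a < b) : 0 < exitRate μ a b := by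
  have := exitFreq_pos hab
  unfold exitRate
  positivity

theorem lt_exitRate {μ l a b : ℝ} (hab : a < b) (hl : 0 ≤ μ ^ 2 - 2 * l) :
    l < exitRate μ a b := by
  have := pow_pos (exitFreq_pos hab) 2
  unfold exitRate
  linarith

/-- The frequency is half of π/(b - a), so the centred phase stays within π/4 on the whole closed
interval, where the cosine is at least √2/2. -/
theorem exp_mul_cos_lower_bound (μ : ℝ) {a b y : ℝ} (ha : a < 0) (hb : 0 < b)
    (hy : y ∈ Set.Icc a b) :
    Real.exp (-|μ| * (b - a)) * (√2 / 2)
      ≤ Real.exp (-μ * y) * Real.cos (exitFreq a b * (y - (a + b) / 2)) := by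
  have hab : 0 < b - a := by linarith
  obtain ⟨h1, h2⟩ := hy
  refine mul_le_mul (Real.exp_le_exp.2 ?_) ?_ (by positivity) (Real.exp_pos _).le
  · have h3 : |y| ≤ b - a := abs_le.2 ⟨by linarith, by linarith⟩
    have h4 : μ * y ≤ |μ| * (b - a) :=
      (le_abs_self _).trans ((abs_mul μ y).le.trans (by gcongr))
    linarith
  · rw [← Real.cos_pi_div_four, ← Real.cos_abs (exitFreq a b * _)]
    refine Real.cos_le_cos_of_nonneg_of_le_pi (abs_nonneg _) (by linarith [Real.pi_pos]) ?_
    have h5 : |y - (a + b) / 2| ≤ (b - a) / 2 := abs_le.2 ⟨by linarith, by linarith⟩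
    rw [abs_mul, abs_of_pos (exitFreq_pos (by linarith))]
    calc exitFreq a b * |y - (a + b) / 2| ≤ exitFreq a b * ((b - a) / 2) := by
          gcongr
          exact (exitFreq_pos (by linarith)).le
      _ = Real.pi / 4 := by
          unfold exitFreq
          field_simp
          norm_num

namespace IsRegularBrownian

variable {B : ℝ≥0 → Ω → ℝ}

theorem integrable_exp_truncExit [IsProbabilityMeasure P] (hB : IsRegularBrownian B P)
    (μ a b l : ℝ) (N : ℕ) :
    Integrable (fun ω => Real.exp (l * (truncExit (driftedBM B μ) a b N ω : ℝ))) P := by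
  have hm := hB.measurable_truncExit μ a b N
  refine Integrable.of_bound (C := Real.exp (|l| * N)) (by fun_prop) (ae_of_all _ fun ω => ?_)
  rw [Real.norm_of_nonneg (Real.exp_pos _).le]
  have h : (truncExit (driftedBM B μ) a b N ω : ℝ) ≤ N := by
    exact_mod_cast truncExit_le (driftedBM B μ) a b N ω
  gcongr
  exact le_abs_self l

theorem integral_exp_truncExit_le [IsProbabilityMeasure P] (hB : IsRegularBrownian B P)
    (μ : ℝ) {a b : ℝ} (ha : a < 0) (hb : 0 < b) (N : ℕ) :
    ∫ ω, Real.exp (exitRate μ a b * (truncExit (driftedBM B μ) a b N ω : ℝ)) ∂P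
      ≤ (Real.exp (-|μ| * (b - a)) * (√2 / 2))⁻¹ := by
  set k := Real.exp (-|μ| * (b - a)) * (√2 / 2) with hk
  have hkpos : 0 < k := by positivity
  set κ := exitFreq a b with hκ
  -- The weight is the phase that centres the cosine at the midpoint of (a, b); its real part, the
  -- initial value of the martingale, is at most 1.
  have h := hB.integral_truncExit μ a b N (Complex.exp (-(κ * ((a + b) / 2) : ℝ) * Complex.I))
    (κ * Complex.I) (l := exitRate μ a b) (by
      rw [mul_pow, Complex.I_sq, exitRate, ← hκ]
      push_cast
      ring)
  have e : ∀ t y : ℝ, (Complex.exp (-(κ * ((a + b) / 2) : ℝ) * Complex.I) *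
      Complex.exp (exitRate μ a b * t + (κ * Complex.I - μ) * y)).re
      = Real.exp (exitRate μ a b * t) *
        (Real.exp (-μ * y) * Real.cos (κ * (y - (a + b) / 2))) := by
    intro t y
    rw [← Complex.exp_add, Complex.exp_re, ← mul_assoc, ← Real.exp_add]
    congr 2
    · simp
    · simp
      ring
  simp only [e] at h
  rw [inv_eq_one_div, le_div_iff₀ hkpos, ← integral_mul_const]
  calc ∫ ω, Real.exp (exitRate μ a b * (truncExit (driftedBM B μ) a b N ω : ℝ)) * k ∂P
      ≤ _ := by
        refine integral_mono ((hB.integrable_exp_truncExit μ a b _ N).mul_const _) h.1 fun ω => ?_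
        exact mul_le_mul_of_nonneg_left
          (exp_mul_cos_lower_bound μ ha hb (hB.driftedBM_truncExit_mem ha hb N ω))
          (Real.exp_pos _).le
    _ = _ := h.2
    _ ≤ 1 := by
        rw [Complex.exp_re]
        simp [Real.cos_le_one]

/-- The exit time is almost surely finite, and its exponential moment of order `exitRate μ a b`
is finite. -/
theorem exists_exit_bound [IsProbabilityMeasure P] (hB : IsRegularBrownian B P)
    (μ : ℝ) {a b : ℝ} (ha : a < 0) (hb : 0 < b) :
    ∃ D : Ω → ℝ, Integrable D P ∧
      (∀ᵐ ω ∂P, ∀ N, Real.exp (exitRate μ a b * (truncExit (driftedBM B μ) a b N ω : ℝ)) ≤ D ω) ∧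
      ∀ᵐ ω ∂P, min (hitBelow (driftedBM B μ) a ω) (hitAbove (driftedBM B μ) b ω) ≠ ⊤ := by
  set F : ℕ → Ω → ENNReal := fun N ω =>
    ENNReal.ofReal (Real.exp (exitRate μ a b * (truncExit (driftedBM B μ) a b N ω : ℝ))) with hF
  have hrate := exitRate_pos μ (ha.trans hb)
  have hFm : ∀ N, Measurable (F N) := fun N => by
    have hm := hB.measurable_truncExit μ a b N
    fun_prop
  have hmono : Monotone F := by
    intro N M h ω
    refine ENNReal.ofReal_le_ofReal (Real.exp_le_exp.2 ?_)
    have := truncExit_mono (driftedBM B μ) a b ω h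
    gcongr
  -- Monotone convergence in `N`: the bound on the truncated moments is uniform.
  have hint : ∫⁻ ω, ⨆ N, F N ω ∂P ≠ ⊤ := by
    rw [lintegral_iSup hFm hmono]
    refine ne_top_of_le_ne_top (b := ENNReal.ofReal (Real.exp (-|μ| * (b - a)) * (√2 / 2))⁻¹)
      ENNReal.ofReal_ne_top (iSup_le fun N => ?_)
    rw [hF, ← ofReal_integral_eq_lintegral_ofReal (hB.integrable_exp_truncExit μ a b _ N)
      (ae_of_all _ fun ω => (Real.exp_pos _).le)]
    exact ENNReal.ofReal_le_ofReal (hB.integral_exp_truncExit_le μ ha hb N)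
  have hfin := ae_lt_top (Measurable.iSup hFm) hint
  have hbound : ∀ᵐ ω ∂P, ∀ N,
      Real.exp (exitRate μ a b * (truncExit (driftedBM B μ) a b N ω : ℝ))
        ≤ (⨆ N, F N ω).toReal := by
    filter_upwards [hfin] with ω hω N
    rw [← ENNReal.ofReal_le_iff_le_toReal hω.ne]
    exact le_iSup (fun N => F N ω) N
  refine ⟨fun ω => (⨆ N, F N ω).toReal,
    integrable_toReal_of_lintegral_ne_top (Measurable.iSup hFm).aemeasurable hint, hbound, ?_⟩
  -- On a path that never exits, the truncated time is `N` itself and the exponentials outgrow the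
  -- finite bound.
  filter_upwards [hbound] with ω hω htop
  have hlim : Tendsto (fun N : ℕ => Real.exp (exitRate μ a b * (N : ℝ))) atTop atTop :=
    Real.tendsto_exp_atTop.comp (tendsto_natCast_atTop_atTop.const_mul_atTop hrate)
  obtain ⟨N, hN⟩ := (hlim.eventually_gt_atTop (⨆ N, F N ω).toReal).exists
  have := hω N
  rw [truncExit_eq_of_top htop] at this
  exact absurd hN (not_lt.2 (by exact_mod_cast this))

theorem measurable_discountBefore (hB : IsRegularBrownian B P) (μ a b ρ : ℝ) :
    Measurable (discountBefore ρ (hitAbove (driftedBM B μ) b) (hitBelow (driftedBM B μ) a)) := by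
  have ha := (hB.isStoppingTime_hitBelow μ a).measurable'
  have hb := (hB.isStoppingTime_hitAbove μ b).measurable'
  refine Measurable.indicator ?_ (measurableSet_lt hb ha)
  have := hb.untopD 0
  fun_prop

/-- Where b is hit first, its hitting time is the exit time, already equal to a late truncation, and
`l` is below the exit rate. -/
theorem integrable_discountBefore [IsProbabilityMeasure P] (hB : IsRegularBrownian B P)
    {μ a b l : ℝ} (ha : a < 0) (hb : 0 < b) (hl : 0 ≤ μ ^ 2 - 2 * l) :
    Integrable (discountBefore (-l) (hitAbove (driftedBM B μ) b) (hitBelow (driftedBM B μ) a))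
      P := by
  obtain ⟨D, hD, hbound, -⟩ := hB.exists_exit_bound μ ha hb
  refine hD.mono' (hB.measurable_discountBefore μ a b _).aestronglyMeasurable ?_
  filter_upwards [hbound] with ω hω
  by_cases hlt : hitAbove (driftedBM B μ) b ω < hitBelow (driftedBM B μ) a ω
  · rw [discountBefore, Set.indicator_of_mem (by exact hlt), neg_neg,
      Real.norm_of_nonneg (Real.exp_pos _).le]
    lift hitAbove (driftedBM B μ) b ω to ℝ≥0 using hlt.ne_top with t ht
    obtain ⟨N, hN⟩ := exists_nat_ge t
    refine le_trans ?_ (hω N)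
    rw [truncExit_eq (t := t) (by rw [← ht, min_eq_right hlt.le]) hN, WithTop.untopD_coe]
    have := lt_exitRate (ha.trans hb) hl
    gcongr
  · rw [discountBefore, Set.indicator_of_notMem (by exact hlt), norm_zero]
    exact (Real.exp_pos _).le.trans (hω 0)

/-- The discounted probability that `W_t + μ t` reaches `b` before `a`. -/
theorem integral_discountBefore [IsProbabilityMeasure P] (hB : IsRegularBrownian B P)
    {μ a b l : ℝ} (ha : a < 0) (hb : 0 < b) (hl : 0 < μ ^ 2 - 2 * l) :
    ∫ ω, discountBefore (-l) (hitAbove (driftedBM B μ) b) (hitBelow (driftedBM B μ) a) ω ∂P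
      = Real.exp (μ * b) * (Real.sinh (√(μ ^ 2 - 2 * l) * -a)
        / Real.sinh (√(μ ^ 2 - 2 * l) * (b - a))) := by
  set θ := √(μ ^ 2 - 2 * l) with hθdef
  have hθ : 0 < θ := Real.sqrt_pos.2 hl
  have hθ2 : θ ^ 2 = μ ^ 2 - 2 * l := Real.sq_sqrt hl.le
  set X := driftedBM B μ with hX
  set g : ℝ → ℝ := fun y => Real.exp (-μ * y) * Real.sinh (θ * (y - a)) with hg
  obtain ⟨D, hD, hbound, hfin⟩ := hB.exists_exit_bound μ ha hb
  have hexit : ∀ N, Integrable (fun ω => Real.exp (l * (truncExit X a b N ω : ℝ)) *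
      g (X (truncExit X a b N ω) ω)) P ∧ ∫ ω, Real.exp (l * (truncExit X a b N ω : ℝ)) *
      g (X (truncExit X a b N ω) ω) ∂P = Real.sinh (θ * -a) := by
    intro N
    -- The weights e^{∓θa}/2 make the difference of the two exponentials the sine that vanishes at
    -- a.
    have h1 := hB.integral_truncExit μ a b N (Real.exp (-θ * a) / 2 : ℝ) (θ : ℂ) (l := l)
      (by rw [← hθ2]; push_cast; ring)
    have h2 := hB.integral_truncExit μ a b N (Real.exp (θ * a) / 2 : ℝ) (-θ : ℂ) (l := l)
      (by rw [← hθ2]; push_cast; ring)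
    have h3 := integral_sub h1.1 h2.1
    have h4 := h1.1.sub' h2.1
    rw [h1.2, h2.2] at h3
    have e : ∀ t y : ℝ, ((Real.exp (-θ * a) / 2 : ℝ) * Complex.exp (l * t + (θ - μ) * y)).re
        - ((Real.exp (θ * a) / 2 : ℝ) * Complex.exp (l * t + (-θ - μ) * y)).re
        = Real.exp (l * t) * g y := by
      intro t y
      have r1 : Complex.exp (l * t + (θ - μ) * y) = (Real.exp (l * t + (θ - μ) * y) : ℝ) := by
        push_cast; rfl
      have r2 : Complex.exp (l * t + (-θ - μ) * y) = (Real.exp (l * t + (-θ - μ) * y) : ℝ) := by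
        push_cast; rfl
      rw [r1, r2, ← Complex.ofReal_mul, ← Complex.ofReal_mul, Complex.ofReal_re,
        Complex.ofReal_re]
      simp only [hg, Real.sinh_eq]
      have q1 : Real.exp (l * t + (θ - μ) * y)
          = Real.exp (l * t) * Real.exp (-μ * y) * Real.exp (θ * y) := by
        rw [← Real.exp_add, ← Real.exp_add]; ring_nf
      have q2 : Real.exp (l * t + (-θ - μ) * y)
          = Real.exp (l * t) * Real.exp (-μ * y) * Real.exp (-(θ * y)) := by
        rw [← Real.exp_add, ← Real.exp_add]; ring_nf
      have q3 : Real.exp (θ * (y - a)) = Real.exp (θ * y) * Real.exp (-θ * a) := by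
        rw [← Real.exp_add]; ring_nf
      have q4 : Real.exp (-(θ * (y - a))) = Real.exp (-(θ * y)) * Real.exp (θ * a) := by
        rw [← Real.exp_add]; ring_nf
      rw [q1, q2, q3, q4]
      ring
    simp only [e] at h3 h4
    refine ⟨h4, ?_⟩
    rw [h3, Complex.ofReal_re, Complex.ofReal_re, Real.sinh_eq]
    ring_nf
  have hlim := tendsto_integral_of_dominated_convergence
    (F := fun N ω => Real.exp (l * (truncExit X a b N ω : ℝ)) * g (X (truncExit X a b N ω) ω))
    (f := fun ω => discountBefore (-l) (hitAbove X b) (hitBelow X a) ω * g b)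
    (fun ω => D ω * (Real.exp (|μ| * (b - a)) * Real.sinh (θ * (b - a)))) (μ := P) ?_
    (hD.mul_const _) ?_ ?_
  · simp only [fun N => (hexit N).2] at hlim
    have h1 := tendsto_nhds_unique hlim tendsto_const_nhds
    rw [integral_mul_const] at h1
    have hs : 0 < Real.sinh (θ * (b - a)) := Real.sinh_pos_iff.2 (by
      have : 0 < b - a := by linarith
      positivity)
    rw [← h1]
    simp only [hg]
    have hexp : Real.exp (-μ * b) * Real.exp (μ * b) = 1 := by
      rw [← Real.exp_add]; simp
    rw [← mul_assoc, mul_div_assoc, div_self hs.ne', mul_one, mul_comm, mul_assoc, hexp, mul_one]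
  · exact fun N => (hexit N).1.aestronglyMeasurable
  · intro N
    filter_upwards [hbound] with ω hω
    have hy := hB.driftedBM_truncExit_mem (μ := μ) ha hb N ω
    rw [← hX] at hy hω
    generalize X (truncExit X a b N ω) ω = y at hy
    obtain ⟨hy1, hy2⟩ := hy
    have hsinh : 0 ≤ Real.sinh (θ * (y - a)) :=
      Real.sinh_nonneg_iff.2 (mul_nonneg hθ.le (by linarith))
    rw [Real.norm_of_nonneg (mul_nonneg (Real.exp_pos _).le
      (mul_nonneg (Real.exp_pos _).le hsinh))]
    have hb1 : Real.exp (l * (truncExit X a b N ω : ℝ)) ≤ D ω := by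
      refine le_trans ?_ (hω N)
      have := lt_exitRate (ha.trans hb) hl.le
      gcongr
    have hb2 : -μ * y ≤ |μ| * (b - a) := by
      have h3 : |y| ≤ b - a := abs_le.2 ⟨by linarith, by linarith⟩
      have := (neg_abs_le (μ * y))
      rw [abs_mul] at this
      nlinarith [mul_le_mul_of_nonneg_left h3 (abs_nonneg μ)]
    have hb3 : Real.sinh (θ * (y - a)) ≤ Real.sinh (θ * (b - a)) :=
      Real.sinh_le_sinh.2 (by gcongr)
    exact mul_le_mul hb1 (mul_le_mul (Real.exp_le_exp.2 hb2) hb3 hsinh (Real.exp_pos _).le)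
      (mul_nonneg (Real.exp_pos _).le hsinh) ((Real.exp_pos _).le.trans hb1)
  · filter_upwards [hfin] with ω hω
    rw [← hX] at hω
    obtain ⟨t, ht⟩ := WithTop.ne_top_iff_exists.1 hω
    have hXt : X t ω ∈ Set.Icc a b := by
      refine mem_Icc_of_le_exit (continuous_driftedBM (hB.cont ω) μ) ?_ ht.le
      simp [driftedBM, hB.zero ω, ha.le, hb.le]
    obtain ⟨M, hM⟩ := exists_nat_ge t
    have hev : ∀ᶠ N : ℕ in atTop, Real.exp (l * t) * g (X t ω)
        = Real.exp (l * (truncExit X a b N ω : ℝ)) * g (X (truncExit X a b N ω) ω) := by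
      filter_upwards [eventually_ge_atTop M] with N hN
      rw [truncExit_eq ht.symm (hM.trans (by exact_mod_cast hN))]
    refine (tendsto_congr' hev).1 ?_
    suffices h : Real.exp (l * t) * g (X t ω)
        = discountBefore (-l) (hitAbove X b) (hitBelow X a) ω * g b by
      rw [h]; exact tendsto_const_nhds
    -- Continuity puts the exit position exactly on a barrier: at b the payoff is the discount
    -- factor times `g b`, at a both sides are zero.
    by_cases hlt : hitAbove X b ω < hitBelow X a ω
    · have hτ : hitAbove X b ω = t := by rw [ht, min_eq_right hlt.le]
      have hmem : b ≤ X t ω :=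
        mem_of_hittingAfter_eq isClosed_Ici (continuous_driftedBM (hB.cont ω) μ) hτ
      rw [discountBefore, Set.indicator_of_mem (by exact hlt), neg_neg, hτ, WithTop.untopD_coe,
        le_antisymm hXt.2 hmem]
    · have hτ : hitBelow X a ω = t := by rw [ht, min_eq_left (not_lt.1 hlt)]
      have hmem : X t ω ≤ a :=
        mem_of_hittingAfter_eq isClosed_Iic (continuous_driftedBM (hB.cont ω) μ) hτ
      rw [discountBefore, Set.indicator_of_notMem (by exact hlt), le_antisymm hmem hXt.1]
      simp [hg]

end IsRegularBrownian

end StockLoan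

/-! ### Closed forms and their critical limit. -/

namespace StockLoan

section ClosedForms

variable {σ a b x : ℝ}

theorem rpow_div_eq_exp {c : ℝ} (hc : 0 < c) (θ σ : ℝ) :
    c ^ (θ / σ) = Real.exp (θ * (1 / σ * Real.log c)) := by
  rw [Real.rpow_def_of_pos hc]
  ring_nf

/-- The price x cancels in log(b/x) - log(a/x) = log(b/a), so C is twice a hyperbolic sine of the
interval length. -/
theorem normC_eq (ha : 0 < a) (hb : 0 < b) (hx : 0 < x) (μ l : ℝ) :
    normC σ a b μ l = 2 * Real.sinh (√(μ ^ 2 - 2 * l)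
      * (1 / σ * Real.log (b / x) - 1 / σ * Real.log (a / x))) := by
  rw [normC, rpow_div_eq_exp (by positivity), rpow_div_eq_exp (by positivity), Real.sinh_eq,
    Real.log_div hb.ne' ha.ne', Real.log_div ha.ne' hb.ne', Real.log_div hb.ne' hx.ne',
    Real.log_div ha.ne' hx.ne']
  ring_nf

theorem expForm_eq (ha : 0 < a) (hb : 0 < b) (hx : 0 < x) (μ l : ℝ) :
    expForm σ a b (1 / σ * Real.log (a / x)) (1 / σ * Real.log (b / x)) μ l
      = Real.exp (μ * (1 / σ * Real.log (b / x))) *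
        (Real.sinh (√(μ ^ 2 - 2 * l) * -(1 / σ * Real.log (a / x)))
          / Real.sinh (√(μ ^ 2 - 2 * l)
            * (1 / σ * Real.log (b / x) - 1 / σ * Real.log (a / x)))) := by
  rw [expForm, normC_eq ha hb hx]
  generalize 1 / σ * Real.log (a / x) = a₁
  generalize 1 / σ * Real.log (b / x) = b₁
  generalize √(μ ^ 2 - 2 * l) = θ
  have h : Real.exp (μ * b₁ - a₁ * θ) - Real.exp (μ * b₁ + a₁ * θ)
      = 2 * Real.exp (μ * b₁) * Real.sinh (θ * -a₁) := by
    rw [sub_eq_add_neg (μ * b₁), Real.exp_add, Real.exp_add, Real.sinh_eq]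
    ring_nf
  rw [h, one_div, mul_inv, div_eq_mul_inv]
  ring

theorem expForm_eq_powForm (ha : 0 < a) (hb : 0 < b) (hx : 0 < x) (μ l : ℝ) :
    expForm σ a b (1 / σ * Real.log (a / x)) (1 / σ * Real.log (b / x)) μ l
      = powForm σ a b x μ l := by
  rw [expForm, powForm, lambda1, lambda2]
  generalize √(μ ^ 2 - 2 * l) = θ
  have e (s : ℝ) : b ^ (μ / σ) * a ^ (s / σ) * x ^ ((-μ - s) / σ)
      = Real.exp (μ * (1 / σ * Real.log (b / x)) + 1 / σ * Real.log (a / x) * s) := by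
    rw [rpow_div_eq_exp hb, rpow_div_eq_exp ha, rpow_div_eq_exp hx, ← Real.exp_add,
      ← Real.exp_add, Real.log_div hb.ne' hx.ne', Real.log_div ha.ne' hx.ne']
    ring_nf
  have e1 := e (-θ)
  rw [sub_neg_eq_add, neg_div, mul_neg, ← sub_eq_add_neg] at e1
  rw [e, e1]

end ClosedForms

/-- As `θ → 0`, `sinh (θ u) / sinh (θ v) → u / v`. -/
theorem tendsto_sinh_div_sinh (u v : ℝ) (hv : v ≠ 0) :
    Tendsto (fun θ : ℝ => Real.sinh (θ * u) / Real.sinh (θ * v)) (𝓝[≠] 0) (𝓝 (u / v)) := by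
  have key (c : ℝ) : Tendsto (fun θ : ℝ => Real.sinh (θ * c) / θ) (𝓝[≠] 0) (𝓝 c) := by
    have h : HasDerivAt (fun θ : ℝ => Real.sinh (θ * c)) c 0 := by
      simpa using ((hasDerivAt_id (0 : ℝ)).mul_const c).sinh
    simpa [div_eq_inv_mul] using h.tendsto_slope_zero
  refine ((key u).div (key v) hv).congr' ?_
  filter_upwards [self_mem_nhdsWithin] with θ hθ
  rw [Pi.div_apply, div_div_div_cancel_right₀ hθ]

/-- Approaching from the left keeps the discriminant positive, so the root avoids 0, where the
quotient of sines degenerates. -/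
theorem tendsto_sqrt_disc {μ lam : ℝ} (h : μ ^ 2 - 2 * lam = 0) :
    Tendsto (fun l => √(μ ^ 2 - 2 * l)) (𝓝[<] lam) (𝓝[≠] 0) := by
  refine tendsto_nhdsWithin_iff.2 ⟨?_, ?_⟩
  · have hc : Continuous fun l : ℝ => √(μ ^ 2 - 2 * l) := by fun_prop
    have := hc.tendsto lam
    rw [h, Real.sqrt_zero] at this
    exact this.mono_left nhdsWithin_le_nhds
  · filter_upwards [self_mem_nhdsWithin] with l hl
    have hl' : l < lam := hl
    exact (Real.sqrt_pos.2 (by linarith)).ne'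

/-! ### Passing from price barriers to barriers for the drifted motion. -/

section Levels

variable {Ω : Type*}

/-- The drift is chosen so that σμ = r - γ - δ - σ²/2, the total coefficient of t in the exponent.
-/
theorem discountedStock_eq (W : ℝ≥0 → Ω → ℝ) {r δ σ γ x : ℝ} (hσ : σ ≠ 0) (t : ℝ≥0) (ω : Ω) :
    discountedStock W r δ σ γ x t ω
      = x * Real.exp (σ * driftedBM W (drift r δ σ γ) t ω) := by
  rw [discountedStock, stock, driftedBM, drift, mul_left_comm, ← Real.exp_add]
  congr 2
  field_simp
  ring

theorem hittingAfter_congr {X Y : ℝ≥0 → Ω → ℝ} {C D : Set ℝ} {ω : Ω}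
    (h : ∀ t, X t ω ∈ C ↔ Y t ω ∈ D) : hittingAfter X C 0 ω = hittingAfter Y D 0 ω := by
  classical
  have hex : (∃ j, 0 ≤ j ∧ X j ω ∈ C) ↔ ∃ j, 0 ≤ j ∧ Y j ω ∈ D := by simp only [h]
  simp only [hittingAfter]
  by_cases hY : ∃ j, 0 ≤ j ∧ Y j ω ∈ D
  · rw [if_pos hY, if_pos (hex.2 hY)]
    simp only [h]
  · rw [if_neg hY, if_neg (hex.not.2 hY)]

theorem hitBelow_discountedStock (W : ℝ≥0 → Ω → ℝ) {r δ σ γ x c : ℝ} (hσ : 0 < σ) (hx : 0 < x)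
    (hc : 0 < c) :
    hitBelow (discountedStock W r δ σ γ x) c
      = hitBelow (driftedBM W (drift r δ σ γ)) (1 / σ * Real.log (c / x)) := by
  ext1 ω
  refine hittingAfter_congr fun t => ?_
  rw [Set.mem_Iic, Set.mem_Iic, discountedStock_eq W hσ.ne', ← le_div_iff₀' hx,
    ← Real.le_log_iff_exp_le (by positivity), one_div, ← div_eq_inv_mul, le_div_iff₀' hσ]

theorem hitAbove_discountedStock (W : ℝ≥0 → Ω → ℝ) {r δ σ γ x c : ℝ} (hσ : 0 < σ) (hx : 0 < x)
    (hc : 0 < c) :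
    hitAbove (discountedStock W r δ σ γ x) c
      = hitAbove (driftedBM W (drift r δ σ γ)) (1 / σ * Real.log (c / x)) := by
  ext1 ω
  refine hittingAfter_congr fun t => ?_
  rw [Set.mem_Ici, Set.mem_Ici, discountedStock_eq W hσ.ne', ← div_le_iff₀' hx,
    ← Real.log_le_iff_le_exp (by positivity), one_div, ← div_eq_inv_mul, div_le_iff₀' hσ]

theorem discountBefore_driftedBM_congr {W B : ℝ≥0 → Ω → ℝ} {ω : Ω} (h : ∀ t, W t ω = B t ω)
    (μ a b ρ : ℝ) :
    discountBefore ρ (hitAbove (driftedBM W μ) b) (hitBelow (driftedBM W μ) a) ω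
      = discountBefore ρ (hitAbove (driftedBM B μ) b) (hitBelow (driftedBM B μ) a) ω := by
  have h1 : hitAbove (driftedBM W μ) b ω = hitAbove (driftedBM B μ) b ω :=
    hittingAfter_congr fun t => by simp only [driftedBM, h]
  have h2 : hitBelow (driftedBM W μ) a ω = hitBelow (driftedBM B μ) a ω :=
    hittingAfter_congr fun t => by simp only [driftedBM, h]
  simp only [discountBefore, Set.indicator, Set.mem_ofPred_eq, h1, h2]

end Levels

/-! ### Left continuity in the rate and the critical value. -/

section Brownian

variable {Ω : Type*} [MeasurableSpace Ω] {P : Measure Ω} [IsProbabilityMeasure P]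
  {B : ℝ≥0 → Ω → ℝ}

/-- The expected discount factor is continuous from the left in the rate, up to the critical
rate. -/
theorem IsRegularBrownian.tendsto_integral_discountBefore (hB : IsRegularBrownian B P)
    {μ a b lam : ℝ} (ha : a < 0) (hb : 0 < b) (hlam : 0 ≤ μ ^ 2 - 2 * lam) :
    Tendsto (fun l => ∫ ω, discountBefore (-l) (hitAbove (driftedBM B μ) b)
      (hitBelow (driftedBM B μ) a) ω ∂P) (𝓝[<] lam)
      (𝓝 (∫ ω, discountBefore (-lam) (hitAbove (driftedBM B μ) b)
        (hitBelow (driftedBM B μ) a) ω ∂P)) := by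
  refine tendsto_integral_filter_of_dominated_convergence _
    (Eventually.of_forall fun l => (hB.measurable_discountBefore μ a b _).aestronglyMeasurable)
    ?_ (hB.integrable_discountBefore ha hb hlam) (ae_of_all _ fun ω => ?_)
  · filter_upwards [self_mem_nhdsWithin] with l hl
    have hl' : l < lam := hl
    refine ae_of_all _ fun ω => ?_
    by_cases hlt : hitAbove (driftedBM B μ) b ω < hitBelow (driftedBM B μ) a ω
    · rw [discountBefore, discountBefore, Set.indicator_of_mem (by exact hlt),
        Set.indicator_of_mem (by exact hlt), Real.norm_of_nonneg (Real.exp_pos _).le, neg_neg,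
        neg_neg]
      gcongr
    · rw [discountBefore, discountBefore, Set.indicator_of_notMem (by exact hlt),
        Set.indicator_of_notMem (by exact hlt), norm_zero]
  · refine Tendsto.mono_left ?_ nhdsWithin_le_nhds
    refine Continuous.tendsto (f := fun l => discountBefore (-l) (hitAbove (driftedBM B μ) b)
      (hitBelow (driftedBM B μ) a) ω) ?_ lam
    unfold discountBefore Set.indicator
    split_ifs
    · fun_prop
    · exact continuous_const

/-- At the critical rate, the expected discount factor is the limit of the closed form. -/
theorem IsRegularBrownian.integral_discountBefore_critical (hB : IsRegularBrownian B P)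
    {μ a b lam : ℝ} (ha : a < 0) (hb : 0 < b) (hlam : μ ^ 2 - 2 * lam = 0) :
    ∫ ω, discountBefore (-lam) (hitAbove (driftedBM B μ) b) (hitBelow (driftedBM B μ) a) ω ∂P
      = Real.exp (μ * b) * (-a / (b - a)) := by
  refine tendsto_nhds_unique (hB.tendsto_integral_discountBefore ha hb hlam.ge) ?_
  refine (((tendsto_sinh_div_sinh (-a) (b - a) (by linarith)).comp
    (tendsto_sqrt_disc hlam)).const_mul (Real.exp (μ * b))).congr' ?_
  filter_upwards [self_mem_nhdsWithin] with l hl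
  have hl' : l < lam := hl
  rw [hB.integral_discountBefore ha hb (by linarith)]
  rfl

end Brownian

end StockLoan

theorem lemma4p1 {Ω : Type*} [MeasurableSpace Ω] (P : Measure Ω) [IsProbabilityMeasure P]
    (W : ℝ≥0 → Ω → ℝ) (hW : IsBrownianReal W P)
    (r δ σ γ a b x : ℝ) (hr : 0 < r) (hδ : 0 ≤ δ) (hσ : 0 < σ)
    (ha : 0 < a) (hax : a < x) (hxb : x < b)
    (μ lam a₁ b₁ : ℝ)
    (hμ : μ = StockLoan.drift r δ σ γ) (hlam : lam = γ - r)
    (ha₁ : a₁ = 1 / σ * Real.log (a / x)) (hb₁ : b₁ = 1 / σ * Real.log (b / x))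
    (τa τb τa₁ τb₁ : Ω → WithTop ℝ≥0)
    (hτa : τa = StockLoan.hitBelow (StockLoan.discountedStock W r δ σ γ x) a)
    (hτb : τb = StockLoan.hitAbove (StockLoan.discountedStock W r δ σ γ x) b)
    (hτa₁ : τa₁ = StockLoan.hitBelow (StockLoan.driftedBM W μ) a₁)
    (hτb₁ : τb₁ = StockLoan.hitAbove (StockLoan.driftedBM W μ) b₁)
    (hdisc : 0 ≤ μ ^ 2 - 2 * lam) :
    Integrable (StockLoan.discountBefore (r - γ) τb τa) P ∧
    Integrable (StockLoan.discountBefore (r - γ) τb₁ τa₁) P ∧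
    ∫ ω, StockLoan.discountBefore (r - γ) τb τa ω ∂P
      = ∫ ω, StockLoan.discountBefore (r - γ) τb₁ τa₁ ω ∂P ∧
    (0 < μ ^ 2 - 2 * lam →
      ∫ ω, StockLoan.discountBefore (r - γ) τb₁ τa₁ ω ∂P
          = StockLoan.expForm σ a b a₁ b₁ μ lam ∧
      StockLoan.expForm σ a b a₁ b₁ μ lam = StockLoan.powForm σ a b x μ lam) ∧
    (μ ^ 2 - 2 * lam = 0 →
      ∫ ω, StockLoan.discountBefore (r - γ) τb₁ τa₁ ω ∂P
          = Real.exp (μ * b₁) * (-a₁ / (b₁ - a₁)) ∧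
      Tendsto (fun l => StockLoan.expForm σ a b a₁ b₁ μ l) (𝓝[<] lam)
        (𝓝 (∫ ω, StockLoan.discountBefore (r - γ) τb₁ τa₁ ω ∂P)) ∧
      Tendsto (fun l => StockLoan.powForm σ a b x μ l) (𝓝[<] lam)
        (𝓝 (∫ ω, StockLoan.discountBefore (r - γ) τb₁ τa₁ ω ∂P))) := by

  subst hτa hτb hτa₁ hτb₁ ha₁ hb₁ hlam hμ
  have hx : 0 < x := ha.trans hax
  have hb : 0 < b := hx.trans hxb
  rw [StockLoan.hitBelow_discountedStock W hσ hx ha, StockLoan.hitAbove_discountedStock W hσ hx hb]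
  have ha₁ : 1 / σ * Real.log (a / x) < 0 :=
    mul_neg_of_pos_of_neg (by positivity) (Real.log_neg (by positivity) ((div_lt_one hx).2 hax))
  have hb₁ : 0 < 1 / σ * Real.log (b / x) :=
    mul_pos (by positivity) (Real.log_pos ((one_lt_div hx).2 hxb))
  have hform := StockLoan.expForm_eq (σ := σ) ha hb hx (StockLoan.drift r δ σ γ)
  have hpow := StockLoan.expForm_eq_powForm (σ := σ) ha hb hx (StockLoan.drift r δ σ γ)
  -- From here only the signs of the two levels and the identities `hform` and `hpow` are needed.
  generalize 1 / σ * Real.log (a / x) = a₁ at *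
  generalize 1 / σ * Real.log (b / x) = b₁ at *
  generalize StockLoan.drift r δ σ γ = μ at *
  obtain ⟨B, hB, hWB⟩ := StockLoan.exists_isRegularBrownian hW
  have hae := hWB.mono fun ω h =>
    StockLoan.discountBefore_driftedBM_congr h μ a₁ b₁ (r - γ)
  rw [integral_congr_ae hae, integrable_congr hae, ← neg_sub γ r]
  generalize γ - r = lam at *
  have hint := hB.integrable_discountBefore ha₁ hb₁ hdisc
  refine ⟨hint, hint, rfl, fun hpos => ⟨?_, hpow lam⟩, fun hzero => ?_⟩
  · rw [hB.integral_discountBefore ha₁ hb₁ hpos, hform]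
  · have hlim : Tendsto (fun l => StockLoan.expForm σ a b a₁ b₁ μ l) (𝓝[<] lam)
        (𝓝 (∫ ω, StockLoan.discountBefore (-lam) (StockLoan.hitAbove (StockLoan.driftedBM B μ) b₁)
          (StockLoan.hitBelow (StockLoan.driftedBM B μ) a₁) ω ∂P)) := by
      refine (hB.tendsto_integral_discountBefore ha₁ hb₁ hdisc).congr' ?_
      -- Each l < λ is strictly subcritical, so the closed form is the expectation at rate l.
      filter_upwards [self_mem_nhdsWithin] with l hl
      have hl' : l < lam := hl
      rw [hB.integral_discountBefore ha₁ hb₁ (by linarith), hform]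
    exact ⟨hB.integral_discountBefore_critical ha₁ hb₁ hzero, hlim,
      hlim.congr fun l => hpow l⟩
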